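/- **Theorem (No False Negatives).** Let $c,C,B,\kappa>0$ be constants. There is a constant $D>0$, depending only on these, such that the following holds for all integers $N\ge 1$ and $0\le s\le k$ with $k/\sqrt N<1$, all coverage factors $\alpha\ge 1$, all $S\in\{2,3\}$, all $T\ge 1$, and all distinct primes $m_1,m_2,m_3$ with $c\sqrt N\le m_i\le C\sqrt N$ and $m_1m_2\ge N$. *Random model.* Let $x\in\mathbb C^N$ be a random signal with DFT $X[f]=\sum_{n} x[n]e^{-2\pi i fn/N}$ whose set of true frequencies $F=\{f\in[0,N):X[f]\neq 0\}$ is uniformly distributed over the $s$-element subsets of $\{0,\dots,N-1\}$ having at most $\kappa k/3$ elements in every contiguous block of length at most $B\sqrt N$ (the nonzero amplitudes are arbitrary). Let the hash parameters $(a_i,b_i)$ be uniform in $[1,m_i-1]\times[0,m_i-1]$, independent across $i=1,2,3$ and independent of $x$, and put $h_i(f)=(a_if+b_i)\bmod m_i$. *Algorithm.* 1. *Views.* For $i=1,2,3$ and shifts $0\le\sigma<S$ form $Y_{i,\sigma}[\beta]=\sum_{f:\,h_i(f)=\beta}X[f]e^{2\pi i\sigma f/N}$, $0\le\beta<m_i$.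 Let $R_i\subseteq[0,m_i)$ be the set of residues $r$ whose bin $(a_ir+b_i)\bmod m_i$ is among the $\lceil\alpha k\rceil$ largest nonzero entries of $|Y_{i,0}|$ (all nonzero entries if there are fewer; ties broken by index). 2. *Gating.* For $(r_1,r_2)\in R_1\times R_2$ let $f_{12}\in[0,m_1m_2)$ be the solution of $f_{12}\equiv r_1\ (m_1)$, $f_{12}\equiv r_2\ (m_2)$. Retain the pair, and the candidate $f_{12}$, if and only if $f_{12}\bmod m_3\in R_3$. 3. *Peeling.* Start from $A=0$ and do $T$ rounds. In each round, let $Z_{i,\sigma}$ be the residual views, i.e. $Y_{i,\sigma}$ minus the contribution of $A$. A candidate $f<N$ passes in view $i$ if $Z_{i,0}[h_i(f)]\ne0$ and $Z_{i,\sigma}[h_i(f)]=Z_{i,0}[h_i(f)]e^{2\pi i\sigma f/N}$ for all $\sigma<S$. For all candidates $f$ passing in some view, simultaneously add $Z_{i,0}[h_i(f)]$ to $A[f]$, with $i$ the first such view. 4. *Output.* If more than $2k$ candidates $f$ have $A[f]=0$, output $X$ (dense DFT); otherwise output the $k$ largest nonzero entries of $A$ (ties broken by index). Say that a true frequency $f\in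 F$ is *lost* if at least one of the following fails: $f\bmod m_i\in R_i$ for $i=1,2,3$; the pair $(f\bmod m_1,f\bmod m_2)$ is retained by the gate and $f$ is a candidate; $A[f]\ne0$ after peeling; $f$ has a nonzero value in the output. Then $$\Pr[\text{some true frequency is lost}]\ \le\ \delta_1:=D\,\frac{k^3}{\sqrt N}.$$ In particular, if $k=k(N)=o(\sqrt N)$, then no true frequency is lost with probability at least $1-O(k^3/\sqrt N)$. -/

import Mathlib

open MeasureTheory ProbabilityTheory

noncomputable section

namespace SparseFFT

/-! ### Spectrum of a signal. Frequencies are the integers `0, …, N - 1`. -/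

/-- The DFT coefficient `X[f] = ∑ n, x[n] exp (-2π i f n / N)` at the integer frequency `f`. -/
def dftCoeff {N : ℕ} [NeZero N] (x : ZMod N → ℂ) (f : ℕ) : ℂ :=
  ZMod.dft x (f : ZMod N)

open Classical in
/-- The set of true frequencies `{f ∈ [0, N) : X[f] ≠ 0}`. -/
def trueFreqs {N : ℕ} [NeZero N] (x : ZMod N → ℂ) : Finset ℕ :=
  (Finset.range N).filter (fun f => dftCoeff x f ≠ 0)

/-- `exp (2π i s f / N)`: the factor by which the shift `n ↦ x[n + s]` multiplies `X[f]`. -/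
def phase (N s f : ℕ) : ℂ :=
  Complex.exp (2 * Real.pi * Complex.I * (s : ℂ) * (f : ℂ) / (N : ℂ))

/-! ### Hashed decimated views -/

/-- The affine hash `(a f + b) mod m`, where `p = (a, b)`. -/
def hashBin (m : ℕ) (p : ℕ × ℕ) (f : ℕ) : ℕ :=
  (p.1 * f + p.2) % m

/-- The residue `r ∈ [0, m)` whose hash is the bin `β`, namely `a⁻¹ (β - b) mod m`. -/
def unhash (m : ℕ) (p : ℕ × ℕ) (β : ℕ) : ℕ :=
  (((p.1 : ZMod m))⁻¹ * ((β : ZMod m) - (p.2 : ZMod m))).val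

/-- The affine family `{(a, b) : a ∈ [1, m - 1], b ∈ [0, m - 1]}`. -/
def affineFamily (m : ℕ) : Finset (ℕ × ℕ) :=
  Finset.Icc 1 (m - 1) ×ˢ Finset.range m

/-- The `m`-bin decimated spectrum of the signal shifted by `s`, in hashed bin order: bin `β`
carries the sum of `X[f] exp (2π i s f / N)` over the frequencies `f ∈ [0, N)` hashed to `β`. -/
def view (N m : ℕ) (p : ℕ × ℕ) (X : ℕ → ℂ) (s β : ℕ) : ℂ :=
  ∑ f ∈ (Finset.range N).filter (fun f => hashBin m p f = β), X f * phase N s f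

open Classical in
/-- The `n` indices `β ∈ [0, M)` at which `Y` is nonzero and largest in modulus (all the indices
of nonzero entries, if there are fewer than `n`); ties are broken in favour of smaller indices. -/
def topIndices (M n : ℕ) (Y : ℕ → ℂ) : Finset ℕ :=
  (Finset.range M).filter (fun β => Y β ≠ 0 ∧
    ((Finset.range M).filter
      (fun γ => ‖Y β‖ < ‖Y γ‖ ∨ (‖Y β‖ = ‖Y γ‖ ∧ γ < β))).card < n)

/-- The set of the top-`⌈α k⌉` occupied residues of one view. -/
def residueSet (N m : ℕ) (p : ℕ × ℕ) (k : ℕ) (α : ℝ) (X : ℕ → ℂ) : Finset ℕ :=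
  (topIndices m ⌈α * k⌉₊ (view N m p X 0)).image (unhash m p)

/-! ### Keyed 2-of-3 gating -/

/-- Two-view Garner reconstruction `r₁ + m₁ ((r₂ - r₁) m₁⁻¹ mod m₂)`. -/
def garner (m₁ m₂ r₁ r₂ : ℕ) : ℕ :=
  r₁ + m₁ * (((r₂ : ZMod m₂) - (r₁ : ZMod m₂)) * ((m₁ : ZMod m₂))⁻¹).val

/-- The residue pairs of the first two views whose reconstruction has an occupied residue in
the third view. -/
def gatedPairs (m : Fin 3 → ℕ) (R : Fin 3 → Finset ℕ) : Finset (ℕ × ℕ) :=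
  (R 0 ×ˢ R 1).filter (fun q => garner (m 0) (m 1) q.1 q.2 % m 2 ∈ R 2)

/-- The frequencies reconstructed from the gated pairs. -/
def candidates (m : Fin 3 → ℕ) (R : Fin 3 → Finset ℕ) : Finset ℕ :=
  (gatedPairs m R).image (fun q => garner (m 0) (m 1) q.1 q.2)

/-! ### Peeling

The state of the peeling phase is the spectrum `A` extracted so far. The residual views are what
is left in the three views, at the shifts `0, …, S - 1`, after subtracting the contribution
of `A`. -/

/-- The residual of view `i` at shift `s` in bin `β`. -/
def residual (N : ℕ) (m : Fin 3 → ℕ) (p : Fin 3 → ℕ × ℕ) (X A : ℕ → ℂ) (i : Fin 3) (s β : ℕ) : ℂ :=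
  view N (m i) (p i) X s β - view N (m i) (p i) A s β

/-- The singleton test for the frequency `f` in view `i`: its bin is nonzero in the residual and
its `S` shifted values are consistent with the single frequency `f`. -/
def SingletonTest (N S : ℕ) (m : Fin 3 → ℕ) (p : Fin 3 → ℕ × ℕ) (X A : ℕ → ℂ) (i : Fin 3)
    (f : ℕ) : Prop :=
  residual N m p X A i 0 (hashBin (m i) (p i) f) ≠ 0 ∧
    ∀ s < S, residual N m p X A i s (hashBin (m i) (p i) f) =
      residual N m p X A i 0 (hashBin (m i) (p i) f) * phase N s f

open Classical in
/-- The amplitude peeled off at `f` in one round, read in the first view in which `f` passes the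
singleton test (zero if there is none). -/
def peelAmplitude (N S : ℕ) (m : Fin 3 → ℕ) (p : Fin 3 → ℕ × ℕ) (X A : ℕ → ℂ) (f : ℕ) : ℂ :=
  if SingletonTest N S m p X A 0 f then residual N m p X A 0 0 (hashBin (m 0) (p 0) f)
  else if SingletonTest N S m p X A 1 f then residual N m p X A 1 0 (hashBin (m 1) (p 1) f)
  else if SingletonTest N S m p X A 2 f then residual N m p X A 2 0 (hashBin (m 2) (p 2) f)
  else 0

/-- One peeling round over the candidate set `K`: all singletons are extracted at once. -/
def peelRound (N S : ℕ) (m : Fin 3 → ℕ) (p : Fin 3 → ℕ × ℕ) (X : ℕ → ℂ) (K : Finset ℕ)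
    (A : ℕ → ℂ) : ℕ → ℂ :=
  fun f => if f ∈ K ∧ f < N then A f + peelAmplitude N S m p X A f else A f

/-- The spectrum extracted in `T` peeling rounds. -/
def peel (N S T : ℕ) (m : Fin 3 → ℕ) (p : Fin 3 → ℕ × ℕ) (X : ℕ → ℂ) (K : Finset ℕ) : ℕ → ℂ :=
  (peelRound N S m p X K)^[T] (fun _ => 0)

/-! ### The whole algorithm -/

/-- Parameters of a run: sparsity `k`, coverage factor `α`, number `S` of time shifts per view,
number `T` of peeling rounds, and the three moduli. -/
structure Params where
  k : ℕ
  α : ℝ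
  S : ℕ
  T : ℕ
  m : Fin 3 → ℕ

/-- The residue sets of the three views of the signal `x`, with hash parameters `p`. -/
def Params.residues (P : Params) {N : ℕ} [NeZero N] (p : Fin 3 → ℕ × ℕ) (x : ZMod N → ℂ)
    (i : Fin 3) : Finset ℕ :=
  residueSet N (P.m i) (p i) P.k P.α (dftCoeff x)

/-- The candidates that pass the gate. -/
def Params.gated (P : Params) {N : ℕ} [NeZero N] (p : Fin 3 → ℕ × ℕ) (x : ZMod N → ℂ) :
    Finset ℕ :=
  candidates P.m (P.residues p x)

/-- The spectrum extracted by peeling. -/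
def Params.peeled (P : Params) {N : ℕ} [NeZero N] (p : Fin 3 → ℕ × ℕ) (x : ZMod N → ℂ) : ℕ → ℂ :=
  peel N P.S P.T P.m p (dftCoeff x) (P.gated p x)

open Classical in
/-- The output: if more than `2 k` candidates remain unpeeled, the dense DFT of `x`;
otherwise the `k` largest entries of the peeled spectrum. -/
def Params.output (P : Params) {N : ℕ} [NeZero N] (p : Fin 3 → ℕ × ℕ) (x : ZMod N → ℂ) (f : ℕ) :
    ℂ :=
  if 2 * P.k < ((P.gated p x).filter (fun g => P.peeled p x g = 0)).card then
    if f < N then dftCoeff x f else 0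
  else
    if f ∈ topIndices N P.k (P.peeled p x) then P.peeled p x f else 0

/-- The frequency `f` survives every stage: its residues are among the selected ones in all the
three views, it passes the gate, it is extracted by peeling, and it occurs in the output. -/
def Params.Survives (P : Params) {N : ℕ} [NeZero N] (p : Fin 3 → ℕ × ℕ) (x : ZMod N → ℂ)
    (f : ℕ) : Prop :=
  (∀ i, f % P.m i ∈ P.residues p x i) ∧
  ((f % P.m 0, f % P.m 1) ∈ gatedPairs P.m (P.residues p x) ∧ f ∈ P.gated p x) ∧
  P.peeled p x f ≠ 0 ∧
  P.output p x f ≠ 0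

/-- Some true frequency of `x` is lost at some stage. -/
def Params.LosesTrueFreq (P : Params) {N : ℕ} [NeZero N] (p : Fin 3 → ℕ × ℕ) (x : ZMod N → ℂ) :
    Prop :=
  ∃ f ∈ trueFreqs x, ¬ P.Survives p x f

/-! ### The standing assumptions -/

open Classical in
/-- The well-distributed placements of `s` frequencies in `[0, N)`: every contiguous block of
length at most `B √N` contains at most `κ k / 3` of them. -/
def wellDistributed (N k s : ℕ) (B κ : ℝ) : Finset (Finset ℕ) :=
  (Finset.powersetCard s (Finset.range N)).filter (fun F =>
    ∀ u L : ℕ, (L : ℝ) ≤ B * √(N : ℝ) →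
      (((F ∩ Finset.Ico u (u + L)).card : ℕ) : ℝ) ≤ κ * ((k : ℝ) / 3))

/-- The standing assumptions on a random signal `x` of length `N` with `s ≤ k` nonzero
frequencies, on the moduli `m` (of order `√N`, with constants `c` and `C`), and on the random hash
parameters `hash i = (a_i, b_i)`. -/
structure StandingAssumptions (c C B κ : ℝ) (N k s : ℕ) [NeZero N] (m : Fin 3 → ℕ)
    {Ω : Type*} [MeasurableSpace Ω] (μ : Measure Ω)
    (x : Ω → ZMod N → ℂ) (hash : Fin 3 → Ω → ℕ × ℕ) : Prop where
  measurable_signal : Measurable x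
  measurable_hash : ∀ i, Measurable (hash i)
  sparse : s ≤ k
  load : (k : ℝ) / √(N : ℝ) < 1
  /-- the nonzero frequencies are `s` in number and well distributed -/
  placement_mem : ∀ ω, trueFreqs (x ω) ∈ wellDistributed N k s B κ
  /-- their placement is uniformly random -/
  placement_uniform : ∀ F ∈ wellDistributed N k s B κ,
    μ {ω | trueFreqs (x ω) = F} = ((wellDistributed N k s B κ).card : ENNReal)⁻¹
  prime_modulus : ∀ i, (m i).Prime
  distinct_moduli : Function.Injective m
  modulus_lower : ∀ i, c * √(N : ℝ) ≤ m i
  modulus_upper : ∀ i, (m i : ℝ) ≤ C * √(N : ℝ)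
  /-- each `(a_i, b_i)` is uniform in the affine family -/
  hash_mem : ∀ i ω, hash i ω ∈ affineFamily (m i)
  hash_uniform : ∀ i, ∀ p ∈ affineFamily (m i),
    μ {ω | hash i ω = p} = ((affineFamily (m i)).card : ENNReal)⁻¹
  /-- the hash parameters are independent across views, and independent of the signal -/
  hash_indep : iIndepFun hash μ
  signal_indep : IndepFun x (fun ω i => hash i ω) μ

end SparseFFT

end

/-! ### Affine hashing, Garner reconstruction and phases. -/

namespace SparseFFT

/-! Since `a` is invertible modulo the prime `m`, two frequencies share a bin exactly when they are
congruent modulo `m`, whatever the hash parameters. If no two true frequencies are congruent modulo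
any `m i`, every occupied bin holds a single one, and the algorithm succeeds deterministically
(`not_losesTrueFreq_of_injOn`). So only the random placement matters, and the loss probability is at
most the proportion of colliding placements.

That proportion is bounded by switching (`card_collidingPlacements_mul_le`): move one member of a
colliding pair to an isolated position. There are at least `N / 2` such positions when `k` is small
against `√N`, while undoing the move leaves at most `s * 3 * s * q` choices with `q` of order `√N`.
The ratio is of order `k ^ 2 / √N`. For larger `k` the claimed bound exceeds 1. -/

lemma hashBin_eq_iff {m : ℕ} (hm : m.Prime) {p : ℕ × ℕ} (hp : p ∈ affineFamily m) (f g : ℕ) :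
    hashBin m p f = hashBin m p g ↔ f % m = g % m := by
  have : Fact m.Prime := ⟨hm⟩
  simp only [affineFamily, Finset.mem_product, Finset.mem_Icc] at hp
  have hcop : Nat.gcd m p.1 = 1 :=
    Nat.coprime_of_lt_prime (by omega) (by omega) hm
  constructor
  · intro h
    exact Nat.ModEq.cancel_left_of_coprime hcop (Nat.ModEq.add_right_cancel' p.2 h)
  · intro h
    exact Nat.ModEq.add_right p.2 (Nat.ModEq.mul_left p.1 h)

lemma unhash_hashBin {m : ℕ} (hm : m.Prime) {p : ℕ × ℕ} (hp : p ∈ affineFamily m) (f : ℕ) :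
    unhash m p (hashBin m p f) = f % m := by
  have : Fact m.Prime := ⟨hm⟩
  simp only [affineFamily, Finset.mem_product, Finset.mem_Icc] at hp
  have h0 : (p.1 : ZMod m) ≠ 0 := by
    rw [Ne, ZMod.natCast_eq_zero_iff]
    intro h
    have := Nat.le_of_dvd (by omega) h
    omega
  simp [unhash, hashBin, h0, ZMod.val_natCast]

/-- Writing `f = f % m₁ + m₁ * (f / m₁)`, the Garner digit is `f / m₁` modulo `m₂`; it is exact
because `f / m₁ < m₂`. -/
lemma garner_mod_mod {m₁ m₂ : ℕ} (h₁ : m₁.Prime) (h₂ : m₂.Prime) (hne : m₁ ≠ m₂) {f : ℕ}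
    (hf : f < m₁ * m₂) : garner m₁ m₂ (f % m₁) (f % m₂) = f := by
  have : Fact m₂.Prime := ⟨h₂⟩
  have h0 : (m₁ : ZMod m₂) ≠ 0 := by
    rw [Ne, ZMod.natCast_eq_zero_iff, Nat.prime_dvd_prime_iff_eq h₂ h₁]
    exact hne.symm
  have key : (((f % m₂ : ℕ) : ZMod m₂) - ((f % m₁ : ℕ) : ZMod m₂)) * (m₁ : ZMod m₂)⁻¹
      = ((f / m₁ : ℕ) : ZMod m₂) := by
    have h := congrArg (Nat.cast : ℕ → ZMod m₂) (Nat.mod_add_div f m₁)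
    push_cast at h
    rw [ZMod.natCast_mod, ← h]
    field_simp
    ring
  rw [garner, key, ZMod.val_natCast, Nat.mod_eq_of_lt (Nat.div_lt_of_lt_mul hf), Nat.mod_add_div]

lemma phase_zero (N f : ℕ) : phase N 0 f = 1 := by
  simp [phase]

/-- `exp (2πi / N)` is a primitive `N`-th root of unity, so shift 1 alone identifies a frequency;
this is why `2 ≤ S` suffices. -/
lemma phase_one_injOn {N f g : ℕ} (hf : f < N) (hg : g < N) (h : phase N 1 f = phase N 1 g) :
    f = g := by
  have hN : N ≠ 0 := by omega
  have e : ∀ j : ℕ, phase N 1 j = Complex.exp (2 * Real.pi * Complex.I / N) ^ j := by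
    intro j
    rw [← Complex.exp_nat_mul, phase]
    congr 1
    push_cast
    ring
  rw [e, e] at h
  exact (Complex.isPrimitiveRoot_exp N hN).pow_inj hf hg h

/-! ### Collision-free views and residue selection. -/

section Views

variable {N m : ℕ} {p : ℕ × ℕ} {X : ℕ → ℂ} {F : Finset ℕ}

lemma view_congr {Y : ℕ → ℂ} (h : ∀ f < N, X f = Y f) (s β : ℕ) :
    view N m p X s β = view N m p Y s β := by
  refine Finset.sum_congr rfl fun f hf => ?_
  rw [h f (Finset.mem_range.1 (Finset.mem_filter.1 hf).1)]

lemma exists_mem_of_view_ne_zero (hF : ∀ f, f ∈ F ↔ f < N ∧ X f ≠ 0) {s β : ℕ}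
    (h : view N m p X s β ≠ 0) : ∃ f ∈ F, hashBin m p f = β := by
  obtain ⟨f, hf, hne⟩ := Finset.exists_ne_zero_of_sum_ne_zero h
  rw [Finset.mem_filter, Finset.mem_range] at hf
  exact ⟨f, (hF f).2 ⟨hf.1, left_ne_zero_of_mul hne⟩, hf.2⟩

lemma view_hashBin_of_injOn (hm : m.Prime) (hp : p ∈ affineFamily m)
    (hF : ∀ f, f ∈ F ↔ f < N ∧ X f ≠ 0) (hinj : Set.InjOn (· % m) (F : Set ℕ)) {f : ℕ}
    (hf : f ∈ F) (s : ℕ) : view N m p X s (hashBin m p f) = X f * phase N s f := by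
  refine Finset.sum_eq_single f (fun g hg hgf => ?_) fun h => ?_
  · rw [Finset.mem_filter, Finset.mem_range, hashBin_eq_iff hm hp] at hg
    by_contra hne
    exact hgf (hinj ((hF g).2 ⟨hg.1, left_ne_zero_of_mul hne⟩) hf hg.2)
  · simp [((hF f).1 hf).1] at h

end Views

/-- Every index ranked ahead of `β` is nonzero, hence in `G`, and `β` itself is a further element of
`G`. -/
lemma mem_topIndices_of_card_le {M n : ℕ} {Y : ℕ → ℂ} {G : Finset ℕ}
    (hG : ∀ γ < M, Y γ ≠ 0 → γ ∈ G) (hn : G.card ≤ n) {β : ℕ} (hβ : β < M) (h : Y β ≠ 0) :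
    β ∈ topIndices M n Y := by
  classical
  simp only [topIndices, Finset.mem_filter, Finset.mem_range]
  refine ⟨hβ, h, lt_of_lt_of_le (Finset.card_lt_card ?_) hn⟩
  refine (Finset.ssubset_iff_of_subset fun γ hγ => ?_).2 ⟨β, hG β hβ h, by simp⟩
  rw [Finset.mem_filter, Finset.mem_range] at hγ
  refine hG γ hγ.1 (norm_pos_iff.1 ((norm_pos_iff.2 h).trans_le ?_))
  rcases hγ.2 with h | h
  · exact h.le
  · exact h.1.le

lemma mod_mem_residueSet {N m k : ℕ} {p : ℕ × ℕ} {X : ℕ → ℂ} {F : Finset ℕ} {α : ℝ} (hα : 1 ≤ α)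
    (hk : F.card ≤ k) (hm : m.Prime) (hp : p ∈ affineFamily m)
    (hF : ∀ f, f ∈ F ↔ f < N ∧ X f ≠ 0) (hinj : Set.InjOn (· % m) (F : Set ℕ)) {f : ℕ}
    (hf : f ∈ F) : f % m ∈ residueSet N m p k α X := by
  refine Finset.mem_image.2 ⟨hashBin m p f, ?_, unhash_hashBin hm hp f⟩
  refine mem_topIndices_of_card_le (G := F.image (hashBin m p)) (fun γ _ hγ => ?_) ?_
    (Nat.mod_lt _ hm.pos) ?_
  · exact Finset.mem_image.2 (exists_mem_of_view_ne_zero hF hγ)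
  · refine Finset.card_image_le.trans (hk.trans ?_)
    have h : (k : ℝ) ≤ α * k := le_mul_of_one_le_left (Nat.cast_nonneg k) hα
    exact_mod_cast h.trans (Nat.le_ceil _)
  · rw [view_hashBin_of_injOn hm hp hF hinj hf, phase_zero, mul_one]
    exact ((hF f).1 hf).2

/-! ### Exact recovery by peeling. -/

section Peeling

variable {N S : ℕ} {m : Fin 3 → ℕ} {p : Fin 3 → ℕ × ℕ} {X : ℕ → ℂ} {F K : Finset ℕ}

lemma residual_zero_right (i : Fin 3) (s β : ℕ) :
    residual N m p X (fun _ => 0) i s β = view N (m i) (p i) X s β := by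
  simp [residual, view]

lemma peelAmplitude_eq_zero {A : ℕ → ℂ} {f : ℕ} (h : ∀ i, ¬ SingletonTest N S m p X A i f) :
    peelAmplitude N S m p X A f = 0 := by
  simp [peelAmplitude, h]

lemma peelAmplitude_zero_of_mem (hm : ∀ i, (m i).Prime) (hp : ∀ i, p i ∈ affineFamily (m i))
    (hF : ∀ f, f ∈ F ↔ f < N ∧ X f ≠ 0) (hinj : ∀ i, Set.InjOn (· % m i) (F : Set ℕ)) {f : ℕ}
    (hf : f ∈ F) : peelAmplitude N S m p X (fun _ => 0) f = X f := by
  have hv : ∀ s, residual N m p X (fun _ => 0) 0 s (hashBin (m 0) (p 0) f) = X f * phase N s f :=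
    fun s => by
      rw [residual_zero_right, view_hashBin_of_injOn (hm 0) (hp 0) hF (hinj 0) hf]
  have ht : SingletonTest N S m p X (fun _ => 0) 0 f := by
    refine ⟨?_, fun s _ => ?_⟩
    · rw [hv, phase_zero, mul_one]
      exact ((hF f).1 hf).2
    · rw [hv, hv, phase_zero, mul_one]
  rw [peelAmplitude, if_pos ht, hv, phase_zero, mul_one]

/-- A nonzero bin holds exactly one true frequency, and the ratio of shifts 1 and 0 reveals its
phase, which no other `f < N` shares. -/
lemma not_singletonTest_of_notMem (hS : 2 ≤ S) (hm : ∀ i, (m i).Prime)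
    (hp : ∀ i, p i ∈ affineFamily (m i)) (hF : ∀ f, f ∈ F ↔ f < N ∧ X f ≠ 0)
    (hinj : ∀ i, Set.InjOn (· % m i) (F : Set ℕ)) {f : ℕ} (hfN : f < N) (hf : f ∉ F)
    (i : Fin 3) : ¬ SingletonTest N S m p X (fun _ => 0) i f := by
  rintro ⟨h0, h1⟩
  have h1 := h1 1 (by omega)
  simp only [residual_zero_right] at h0 h1
  obtain ⟨g, hg, hgf⟩ := exists_mem_of_view_ne_zero hF h0
  rw [← hgf, view_hashBin_of_injOn (hm i) (hp i) hF (hinj i) hg,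
    view_hashBin_of_injOn (hm i) (hp i) hF (hinj i) hg, phase_zero, mul_one] at h1
  have hgN := (hF g).1 hg
  have := phase_one_injOn hgN.1 hfN (mul_left_cancel₀ hgN.2 h1)
  exact hf (this ▸ hg)

open Classical in
lemma peelRound_zero (hS : 2 ≤ S) (hm : ∀ i, (m i).Prime)
    (hp : ∀ i, p i ∈ affineFamily (m i)) (hF : ∀ f, f ∈ F ↔ f < N ∧ X f ≠ 0)
    (hinj : ∀ i, Set.InjOn (· % m i) (F : Set ℕ)) (hK : F ⊆ K) :
    peelRound N S m p X K (fun _ => 0) = fun f => if f ∈ F then X f else 0 := by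
  funext f
  by_cases hf : f ∈ F
  · rw [peelRound, if_pos ⟨hK hf, ((hF f).1 hf).1⟩, if_pos hf, zero_add,
      peelAmplitude_zero_of_mem hm hp hF hinj hf]
  · rw [peelRound, if_neg hf]
    split_ifs with h
    · rw [zero_add, peelAmplitude_eq_zero
        (not_singletonTest_of_notMem hS hm hp hF hinj h.2 hf)]
    · rfl

lemma peelRound_eq_self {A : ℕ → ℂ} (hA : ∀ f < N, X f = A f) :
    peelRound N S m p X K A = A := by
  funext f
  rw [peelRound, peelAmplitude_eq_zero fun i h => h.1 ?_, add_zero, ite_self]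
  rw [residual, view_congr hA, sub_self]

open Classical in
/-- Without collisions among the true frequencies, peeling recovers the spectrum exactly. -/
lemma peel_eq {T : ℕ} (hT : 1 ≤ T) (hS : 2 ≤ S) (hm : ∀ i, (m i).Prime)
    (hp : ∀ i, p i ∈ affineFamily (m i)) (hF : ∀ f, f ∈ F ↔ f < N ∧ X f ≠ 0)
    (hinj : ∀ i, Set.InjOn (· % m i) (F : Set ℕ)) (hK : F ⊆ K) :
    peel N S T m p X K = fun f => if f ∈ F then X f else 0 := by
  obtain ⟨t, rfl⟩ : ∃ t, T = t + 1 := ⟨T - 1, by omega⟩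
  -- The first round already extracts all of `X`; the residuals then vanish and later rounds change
  -- nothing.
  rw [peel, Function.iterate_succ_apply, peelRound_zero hS hm hp hF hinj hK]
  refine Function.iterate_fixed (peelRound_eq_self fun f hf => ?_) t
  split_ifs with h
  · rfl
  · by_contra hne
    exact h ((hF f).2 ⟨hf, hne⟩)

end Peeling

/-- If no two true frequencies are congruent modulo one of the moduli, none of them is lost. -/
theorem not_losesTrueFreq_of_injOn {N : ℕ} [NeZero N] {P : Params} {p : Fin 3 → ℕ × ℕ}
    {x : ZMod N → ℂ} (hα : 1 ≤ P.α) (hS : 2 ≤ P.S) (hT : 1 ≤ P.T) (hN : N ≤ P.m 0 * P.m 1)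
    (hm : ∀ i, (P.m i).Prime) (hne : P.m 0 ≠ P.m 1) (hp : ∀ i, p i ∈ affineFamily (P.m i))
    (hk : (trueFreqs x).card ≤ P.k)
    (hinj : ∀ i, Set.InjOn (· % P.m i) (trueFreqs x : Set ℕ)) : ¬ P.LosesTrueFreq p x := by
  classical
  have hF : ∀ f, f ∈ trueFreqs x ↔ f < N ∧ dftCoeff x f ≠ 0 := by simp [trueFreqs]
  have hres : ∀ f ∈ trueFreqs x, ∀ i, f % P.m i ∈ P.residues p x i := fun f hf i =>
    mod_mem_residueSet hα hk (hm i) (hp i) hF (hinj i) hf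
  have hgar : ∀ f ∈ trueFreqs x, garner (P.m 0) (P.m 1) (f % P.m 0) (f % P.m 1) = f :=
    fun f hf => garner_mod_mod (hm 0) (hm 1) hne (((hF f).1 hf).1.trans_le hN)
  have hpair : ∀ f ∈ trueFreqs x,
      (f % P.m 0, f % P.m 1) ∈ gatedPairs P.m (P.residues p x) := fun f hf => by
    simp only [gatedPairs, Finset.mem_filter, Finset.mem_product]
    rw [hgar f hf]
    exact ⟨⟨hres f hf 0, hres f hf 1⟩, hres f hf 2⟩
  have hgated : trueFreqs x ⊆ P.gated p x := fun f hf =>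
    Finset.mem_image.2 ⟨_, hpair f hf, hgar f hf⟩
  have hpeel : P.peeled p x = fun f => if f ∈ trueFreqs x then dftCoeff x f else 0 :=
    peel_eq hT hS hm hp hF hinj hgated
  rintro ⟨f, hf, hlost⟩
  have hX := (hF f).1 hf
  have hA : P.peeled p x f ≠ 0 := by
    rw [hpeel]
    simpa [hf] using hX.2
  refine hlost ⟨hres f hf, ⟨hpair f hf, hgated hf⟩, hA, ?_⟩
  rw [Params.output]
  -- The peeled spectrum is supported on at most `k` frequencies, so truncation to `k` entries drops
  -- none.
  have htop : f ∈ topIndices N P.k (P.peeled p x) := by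
    refine mem_topIndices_of_card_le (fun g _ hg => ?_) hk hX.1 hA
    by_contra hgF
    simp [hpeel, hgF] at hg
  rw [if_pos htop, if_pos hX.1]
  split_ifs
  · exact hX.2
  · exact hA

/-! ### Counting the placements with collisions -/

open Classical in
/-- The well-distributed placements with two frequencies congruent modulo one of the `m i`. -/
noncomputable def collidingPlacements (N k s : ℕ) (B κ : ℝ) (m : Fin 3 → ℕ) : Finset (Finset ℕ) :=
  (wellDistributed N k s B κ).filter (fun F => ∃ i, ∃ f ∈ F, ∃ g ∈ F, f ≠ g ∧ f % m i = g % m i)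

/-- Moving one frequency of a well-distributed placement to an isolated position `g` gives
a well-distributed placement. -/
lemma insert_erase_mem_wellDistributed {N k s f g : ℕ} {B κ : ℝ} {F : Finset ℕ}
    (hF : F ∈ wellDistributed N k s B κ) (hf : f ∈ F) (hgN : g < N)
    (hg : ∀ e ∈ F.erase f, (e : ℝ) + B * √(N : ℝ) ≤ g ∨ (g : ℝ) + B * √(N : ℝ) ≤ e)
    (hgF : g ∉ F.erase f) : insert g (F.erase f) ∈ wellDistributed N k s B κ := by
  simp only [wellDistributed, Finset.mem_filter, Finset.mem_powersetCard] at hF ⊢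
  obtain ⟨⟨hsub, hcard⟩, hload⟩ := hF
  have hpos : 0 < F.card := Finset.card_pos.2 ⟨f, hf⟩
  refine ⟨⟨?_, ?_⟩, fun u L hL => ?_⟩
  · exact Finset.insert_subset (Finset.mem_range.2 hgN) ((Finset.erase_subset _ _).trans hsub)
  · rw [Finset.card_insert_of_notMem hgF, Finset.card_erase_of_mem hf]
    omega
  · by_cases hgu : g ∈ Finset.Ico u (u + L)
    · have h1 : insert g (F.erase f) ∩ Finset.Ico u (u + L) ⊆ {g} := by
        intro e he
        rw [Finset.mem_inter, Finset.mem_insert] at he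
        rw [Finset.mem_singleton]
        rcases he.1 with h | h
        · exact h
        · have h2 := he.2
          rw [Finset.mem_Ico] at hgu h2
          exfalso
          rcases hg e h with h3 | h3
          · have : e + L ≤ g := by exact_mod_cast (by linarith : (e : ℝ) + L ≤ g)
            omega
          · have : g + L ≤ e := by exact_mod_cast (by linarith : (g : ℝ) + L ≤ e)
            omega
      -- The length-one block at `f` is admissible and contains `f ∈ F`, so the load bound is at
      -- least 1, enough for a block containing only `g`.
      have hL1 : ((1 : ℕ) : ℝ) ≤ B * √(N : ℝ) := by
        refine le_trans ?_ hL
        rw [Finset.mem_Ico] at hgu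
        exact_mod_cast (by omega : 1 ≤ L)
      refine le_trans ?_ (hload f 1 hL1)
      have h2 := Finset.card_le_card h1
      have h3 : 0 < (F ∩ Finset.Ico f (f + 1)).card := Finset.card_pos.2 ⟨f, by simp [hf]⟩
      rw [Finset.card_singleton] at h2
      exact_mod_cast h2.trans h3
    · refine le_trans ?_ (hload u L hL)
      refine Nat.cast_le.2 (Finset.card_le_card fun e he => ?_)
      rw [Finset.mem_inter, Finset.mem_insert] at he
      rcases he.1 with rfl | h
      · exact absurd he.2 hgu
      · exact Finset.mem_inter.2 ⟨Finset.mem_of_mem_erase h, he.2⟩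

open Classical in
/-- The positions in `[0, N)` at distance less than `B √N` from some element of `E`. -/
noncomputable def nearPositions (N : ℕ) (B : ℝ) (E : Finset ℕ) : Finset ℕ :=
  E.biUnion fun e => Finset.Icc (e - ⌈B * √(N : ℝ)⌉₊) (e + ⌈B * √(N : ℝ)⌉₊)

lemma card_nearPositions_le (N : ℕ) (B : ℝ) (E : Finset ℕ) :
    (nearPositions N B E).card ≤ E.card * (2 * ⌈B * √(N : ℝ)⌉₊ + 1) := by
  refine Finset.card_biUnion_le_card_mul _ _ _ fun e _ => ?_
  rw [Nat.card_Icc]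
  omega

lemma card_filter_mod_eq_le (N m r : ℕ) :
    ((Finset.range N).filter (fun f => f % m = r)).card ≤ N / m + 1 := by
  rw [← Finset.card_range (N / m + 1)]
  refine Finset.card_le_card_of_injOn (· / m) (fun f hf => ?_) fun f hf g hg h => ?_
  · simp only [Finset.coe_filter, Finset.mem_range, Set.mem_ofPred_eq] at hf
    simp only [Finset.coe_range, Set.mem_Iio]
    exact Nat.lt_succ_of_le (Nat.div_le_div_right hf.1.le)
  · simp only [Finset.coe_filter, Finset.mem_range, Set.mem_ofPred_eq] at hf hg
    rw [← Nat.div_add_mod f m, ← Nat.div_add_mod g m, hf.2, hg.2, show f / m = g / m from h]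

/-- Double counting: moving one frequency of a colliding pair to an isolated position. -/
lemma card_collidingPlacements_mul_le {N k s q L : ℕ} {B κ : ℝ} {m : Fin 3 → ℕ}
    (hq : ∀ i, N / m i + 1 ≤ q)
    (hL : s * (2 * ⌈B * √(N : ℝ)⌉₊ + 1) + L ≤ N) :
    (collidingPlacements N k s B κ m).card * L ≤
      (wellDistributed N k s B κ).card * (s * (3 * (s * q))) := by
  classical
  have hex : ∀ F ∈ collidingPlacements N k s B κ m, ∃ f ∈ F, ∃ i, ∃ e ∈ F.erase f,
      f % m i = e % m i := by
    intro F hF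
    obtain ⟨i, f, hf, g, hg, hne, h⟩ := (Finset.mem_filter.1 hF).2
    exact ⟨f, hf, i, g, Finset.mem_erase.2 ⟨hne.symm, hg⟩, h⟩
  -- `φ F` is the frequency to move; its colliding partner stays in `F.erase (φ F)`.
  choose! φ hφ hcol using hex
  -- The excluded radius is rounded up, so free positions are at real distance at least `B * √N`
  -- from the remaining frequencies.
  let free : Finset ℕ → Finset ℕ := fun F =>
    Finset.range N \ nearPositions N B (F.erase (φ F))
  let src := (collidingPlacements N k s B κ m).sigma free
  -- A target records the new placement, the new position in it, and the old position, which is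
  -- congruent to some member of the new placement.
  let tgt := (wellDistributed N k s B κ).sigma fun G : Finset ℕ => G.sigma fun _ : ℕ =>
    (Finset.univ : Finset (Fin 3)).biUnion fun i => G.biUnion fun e =>
      (Finset.range N).filter (fun f => f % m i = e % m i)
  have hwd : ∀ F ∈ collidingPlacements N k s B κ m, F ∈ wellDistributed N k s B κ :=
    fun F hF => (Finset.mem_filter.1 hF).1
  have hwd' : ∀ F ∈ wellDistributed N k s B κ, F ⊆ Finset.range N ∧ F.card = s :=
    fun F hF => Finset.mem_powersetCard.1 (Finset.mem_filter.1 hF).1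
  have hfar : ∀ F, ∀ g ∈ free F, g < N ∧ g ∉ F.erase (φ F) ∧ ∀ e ∈ F.erase (φ F),
      (e : ℝ) + B * √(N : ℝ) ≤ g ∨ (g : ℝ) + B * √(N : ℝ) ≤ e := by
    intro F g hg
    simp only [free, Finset.mem_sdiff, Finset.mem_range, nearPositions, Finset.mem_biUnion,
      not_exists, not_and, Finset.mem_Icc] at hg
    refine ⟨hg.1, fun h => hg.2 g h (by omega) (by omega), fun e he => ?_⟩
    have h1 := hg.2 e he
    have hc := Nat.le_ceil (B * √(N : ℝ))
    set c := ⌈B * √(N : ℝ)⌉₊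
    by_cases h2 : e + c ≤ g
    · left
      have : (e : ℝ) + c ≤ g := by exact_mod_cast h2
      linarith
    · right
      have : (g : ℝ) + c ≤ e := by exact_mod_cast (by omega : g + c ≤ e)
      linarith
  have hsrc : (collidingPlacements N k s B κ m).card * L ≤ src.card := by
    rw [Finset.card_sigma, ← smul_eq_mul]
    refine Finset.card_nsmul_le_sum _ _ _ fun F hF => ?_
    have h1 := Finset.le_card_sdiff (nearPositions N B (F.erase (φ F))) (Finset.range N)
    have h2 := card_nearPositions_le N B (F.erase (φ F))
    have h3 : (F.erase (φ F)).card ≤ s :=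
      (Finset.card_erase_le).trans (hwd' F (hwd F hF)).2.le
    have h4 := Nat.mul_le_mul_right (2 * ⌈B * √(N : ℝ)⌉₊ + 1) h3
    rw [Finset.card_range] at h1
    change L ≤ (Finset.range N \ nearPositions N B (F.erase (φ F))).card
    omega
  have htgt : tgt.card ≤ (wellDistributed N k s B κ).card * (s * (3 * (s * q))) := by
    rw [Finset.card_sigma, ← smul_eq_mul]
    refine Finset.sum_le_card_nsmul _ _ _ fun G hG => ?_
    rw [Finset.card_sigma, ← (hwd' G hG).2, ← smul_eq_mul]
    refine Finset.sum_le_card_nsmul _ _ _ fun _ _ => ?_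
    refine Finset.card_biUnion_le_card_mul Finset.univ _ _ fun i _ => ?_
    exact Finset.card_biUnion_le_card_mul _ _ _ fun e _ =>
      (card_filter_mod_eq_le _ _ _).trans (hq i)
  refine hsrc.trans (le_trans ?_ htgt)
  refine Finset.card_le_card_of_injOn
    (fun a => ⟨insert a.2 (a.1.erase (φ a.1)), a.2, φ a.1⟩) ?_ ?_
  · rintro ⟨F, g⟩ h
    obtain ⟨hF, hg⟩ := Finset.mem_sigma.1 h
    obtain ⟨hgN, hgF, hgfar⟩ := hfar F g hg
    obtain ⟨i, e, he, hmod⟩ := hcol F hF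
    refine Finset.mem_sigma.2 ⟨insert_erase_mem_wellDistributed (hwd F hF) (hφ F hF) hgN hgfar hgF,
      Finset.mem_sigma.2 ⟨Finset.mem_insert_self _ _, ?_⟩⟩
    simp only [Finset.mem_biUnion, Finset.mem_filter, Finset.mem_univ, true_and]
    exact ⟨i, e, Finset.mem_insert_of_mem he, (hwd' F (hwd F hF)).1 (hφ F hF), hmod⟩
  · rintro ⟨F, g⟩ hFg ⟨F', g'⟩ hFg' h
    obtain ⟨hF, hg⟩ := Finset.mem_sigma.1 hFg
    obtain ⟨hF', hg'⟩ := Finset.mem_sigma.1 hFg'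
    simp only [Sigma.mk.injEq, heq_eq_eq] at h
    obtain ⟨h1, rfl, h3⟩ := h
    -- The move is undone by erasing the new position and reinserting the old one.
    have h4 := congrArg (fun G => insert (φ F) (Finset.erase G g)) h1
    simp only [Finset.erase_insert (hfar F g hg).2.1, Finset.erase_insert (hfar F' g hg').2.1] at h4
    rw [Finset.insert_erase (hφ F hF), h3, Finset.insert_erase (hφ F' hF')] at h4
    rw [h4]

/-- Real-valued form of the double counting, for sparsities small compared to `√N`. -/
lemma card_collidingPlacements_le {N k s : ℕ} {c B κ : ℝ} {m : Fin 3 → ℕ} (hc : 0 < c)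
    (hB : 0 < B) (hN : 1 ≤ N) (hm : ∀ i, 0 < m i) (hcm : ∀ i, c * √(N : ℝ) ≤ m i) (hs : s ≤ k)
    (hk : (k : ℝ) * (4 * B + 6) ≤ √(N : ℝ)) :
    ((collidingPlacements N k s B κ m).card : ℝ) ≤
      (wellDistributed N k s B κ).card * (6 * (c⁻¹ + 2) * ((k : ℝ) ^ 3 / √(N : ℝ))) := by
  have hr1 : (1 : ℝ) ≤ √(N : ℝ) := Real.one_le_sqrt.2 (by exact_mod_cast hN)
  have hr2 : √(N : ℝ) * √(N : ℝ) = N := Real.mul_self_sqrt (Nat.cast_nonneg N)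
  set r := √(N : ℝ) with hr
  have hr0 : 0 < r := by linarith
  have hsk : (s : ℝ) ≤ k := by exact_mod_cast hs
  set q := ⌈c⁻¹ * r⌉₊ + 1 with hqdef
  have hq : ∀ i, N / m i + 1 ≤ q := by
    intro i
    refine Nat.succ_le_succ ?_
    have h1 : ((N / m i : ℕ) : ℝ) ≤ c⁻¹ * r := by
      refine Nat.cast_div_le.trans ?_
      rw [div_le_iff₀ (by exact_mod_cast hm i), ← hr2]
      calc r * r = c⁻¹ * r * (c * r) := by field_simp
        _ ≤ c⁻¹ * r * m i := by gcongr; exact hcm i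
    exact_mod_cast h1.trans (Nat.le_ceil _)
  -- The `+ 2` absorbs the ceiling and the extra 1, as `1 ≤ r`.
  have hqr : (q : ℝ) ≤ (c⁻¹ + 2) * r := by
    have := (Nat.ceil_lt_add_one (by positivity : 0 ≤ c⁻¹ * r)).le
    rw [hqdef]
    push_cast
    linarith
  -- The factor `4 * B + 6` in `hk` is twice `2 * B + 3`, so at most half of the positions are
  -- excluded.
  have hnear : (s : ℝ) * (2 * ⌈B * r⌉₊ + 1) ≤ N / 2 := by
    have h1 := (Nat.ceil_lt_add_one (by positivity : 0 ≤ B * r)).le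
    calc (s : ℝ) * (2 * ⌈B * r⌉₊ + 1) ≤ k * ((2 * B + 3) * r) := by
          gcongr
          linarith
      _ = k * (4 * B + 6) * r / 2 := by ring
      _ ≤ r * r / 2 := by gcongr
      _ = N / 2 := by rw [hr2]
  set L := N - s * (2 * ⌈B * r⌉₊ + 1) with hLdef
  have hle : s * (2 * ⌈B * r⌉₊ + 1) ≤ N := by
    have h0 : (0 : ℝ) ≤ N := Nat.cast_nonneg N
    exact_mod_cast (by linarith : (s : ℝ) * (2 * ⌈B * r⌉₊ + 1) ≤ N)
  have hL : (N : ℝ) / 2 ≤ L := by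
    rw [hLdef, Nat.cast_sub hle]
    push_cast
    linarith
  have hcount := card_collidingPlacements_mul_le (k := k) (κ := κ) hq
    (by rw [← hr]; omega : s * (2 * ⌈B * √(N : ℝ)⌉₊ + 1) + L ≤ N)
  set b := (collidingPlacements N k s B κ m).card
  set w := (wellDistributed N k s B κ).card
  have hcount' : (b : ℝ) * L ≤ w * (s * (3 * (s * q))) := by exact_mod_cast hcount
  -- The count gives `k ^ 2`; it is weakened to the cube of the statement.
  have hk3 : (k : ℝ) ^ 2 ≤ (k : ℝ) ^ 3 := by
    exact_mod_cast (by
      rcases Nat.eq_zero_or_pos k with h | h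
      · simp [h]
      · exact Nat.pow_le_pow_right h (by norm_num) : k ^ 2 ≤ k ^ 3)
  have h1 : (b : ℝ) * (r * r / 2) ≤ w * (3 * (c⁻¹ + 2) * (k : ℝ) ^ 3 * r) := by
    calc (b : ℝ) * (r * r / 2) ≤ b * L := by gcongr; rw [hr2]; exact hL
      _ ≤ w * (s * (3 * (s * q))) := hcount'
      _ ≤ w * (k * (3 * (k * ((c⁻¹ + 2) * r)))) := by gcongr
      _ = w * (3 * (c⁻¹ + 2) * (k : ℝ) ^ 2 * r) := by ring
      _ ≤ w * (3 * (c⁻¹ + 2) * (k : ℝ) ^ 3 * r) := by gcongr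
  have h2 : w * (3 * (c⁻¹ + 2) * (k : ℝ) ^ 3 * r)
      = w * (6 * (c⁻¹ + 2) * ((k : ℝ) ^ 3 / r)) * (r * r / 2) := by
    field_simp
    ring
  rw [h2] at h1
  exact le_of_mul_le_mul_right h1 (by positivity)

/-- The probability of a collision is at most the proportion of colliding placements. -/
lemma measure_losesTrueFreq_le {c C B κ : ℝ} {N s : ℕ} [NeZero N] {P : Params} {Ω : Type*}
    [MeasurableSpace Ω] {μ : Measure Ω} {x : Ω → ZMod N → ℂ} {hash : Fin 3 → Ω → ℕ × ℕ}
    (hα : 1 ≤ P.α) (hS : 2 ≤ P.S) (hT : 1 ≤ P.T) (hN : N ≤ P.m 0 * P.m 1)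
    (h : StandingAssumptions c C B κ N P.k s P.m μ x hash) :
    μ {ω | P.LosesTrueFreq (fun i => hash i ω) (x ω)} ≤
      (collidingPlacements N P.k s B κ P.m).card *
        ((wellDistributed N P.k s B κ).card : ENNReal)⁻¹ := by
  classical
  have hsub : {ω | P.LosesTrueFreq (fun i => hash i ω) (x ω)} ⊆
      ⋃ F ∈ collidingPlacements N P.k s B κ P.m, {ω | trueFreqs (x ω) = F} := by
    intro ω hω
    simp only [Set.mem_iUnion, Set.mem_ofPred_eq, exists_prop, exists_eq_right']
    by_contra hnot
    have hmem := h.placement_mem ω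
    refine not_losesTrueFreq_of_injOn hα hS hT hN h.prime_modulus
      (h.distinct_moduli.ne (by decide)) (fun i => h.hash_mem i ω) ?_ (fun i f hf g hg hfg => ?_) hω
    · rw [(Finset.mem_powersetCard.1 (Finset.mem_filter.1 hmem).1).2]
      exact h.sparse
    · by_contra hne
      exact hnot (Finset.mem_filter.2 ⟨hmem, i, f, hf, g, hg, hne, hfg⟩)
  refine (measure_mono hsub).trans ((measure_biUnion_finset_le _ _).trans ?_)
  refine (Finset.sum_congr rfl fun F hF =>
    h.placement_uniform F (Finset.mem_filter.1 hF).1).le.trans ?_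
  rw [Finset.sum_const, nsmul_eq_mul, collidingPlacements]

end SparseFFT

theorem mainTheorem9 (c C B κ : ℝ) (hc : 0 < c) (hC : 0 < C) (hB : 0 < B) (hκ : 0 < κ) :
    ∃ D : ℝ, 0 < D ∧
      ∀ (N : ℕ) [NeZero N] (s : ℕ) (P : SparseFFT.Params)
        (Ω : Type*) [MeasurableSpace Ω] (μ : Measure Ω) [IsProbabilityMeasure μ]
        (x : Ω → ZMod N → ℂ) (hash : Fin 3 → Ω → ℕ × ℕ),
        1 ≤ P.α → (P.S = 2 ∨ P.S = 3) → 1 ≤ P.T → N ≤ P.m 0 * P.m 1 →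
        SparseFFT.StandingAssumptions c C B κ N P.k s P.m μ x hash →
        μ {ω | P.LosesTrueFreq (fun i => hash i ω) (x ω)} ≤
          ENNReal.ofReal (D * ((P.k : ℝ) ^ 3 / √(N : ℝ))) := by
  -- The first constant serves the switching bound, the second makes the bound trivial when `√N < k
  -- * (4 * B + 6)`.
  have hD : 0 < max (6 * (c⁻¹ + 2)) (4 * B + 6) := lt_max_of_lt_right (by positivity)
  refine ⟨_, hD, ?_⟩
  intro N _ s P Ω _ μ _ x hash hα hS hT hN h
  have hN1 : 1 ≤ N := NeZero.one_le
  have hr1 : (1 : ℝ) ≤ √(N : ℝ) := Real.one_le_sqrt.2 (by exact_mod_cast hN1)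
  rcases le_or_gt ((P.k : ℝ) * (4 * B + 6)) √(N : ℝ) with hk | hk
  · refine (SparseFFT.measure_losesTrueFreq_le hα (by omega) hT hN h).trans ?_
    have hle := SparseFFT.card_collidingPlacements_le (κ := κ) hc hB hN1
      (fun i => (h.prime_modulus i).pos) h.modulus_lower h.sparse hk
    -- A sample point supplies a well-distributed placement, so the division is by a positive count.
    obtain ⟨ω⟩ : Nonempty Ω := nonempty_of_isProbabilityMeasure μ
    have hw : 0 < (SparseFFT.wellDistributed N P.k s B κ).card :=
      Finset.card_pos.2 ⟨_, h.placement_mem ω⟩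
    have hw' : (0 : ℝ) < (SparseFFT.wellDistributed N P.k s B κ).card := by exact_mod_cast hw
    rw [← div_eq_mul_inv, ← ENNReal.ofReal_natCast, ← ENNReal.ofReal_natCast,
      ← ENNReal.ofReal_div_of_pos hw']
    refine ENNReal.ofReal_le_ofReal (((div_le_iff₀' hw').2 hle).trans ?_)
    gcongr
    exact le_max_left _ _
  · refine prob_le_one.trans ?_
    rw [ENNReal.one_le_ofReal, ← mul_div_assoc, one_le_div (by linarith)]
    have hk0 : P.k ≠ 0 := by
      intro h0
      rw [h0, Nat.cast_zero, zero_mul] at hk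
      linarith
    have hk3 : (P.k : ℝ) ≤ (P.k : ℝ) ^ 3 := by
      exact_mod_cast Nat.le_self_pow (by norm_num) P.k
    calc √(N : ℝ) ≤ P.k * (4 * B + 6) := hk.le
      _ ≤ (P.k : ℝ) ^ 3 * max (6 * (c⁻¹ + 2)) (4 * B + 6) := by
          gcongr
          exact le_max_right _ _
      _ = _ := mul_comm _ _
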